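/- **Notation.** Let $p>2$ be a prime, let $N, m\ge 1$ and $r\ge 0$ be integers with $p\nmid N$, and put $M=Np^r$. For a finite set $W$ of positive integers let $S_W=\bigoplus_{k\in W}S_k(\Gamma_1(M))$ be the space of holomorphic cusp forms with weights in $W$, and let $\mathbb{T}_{\mathbb Z}(S_W)\subseteq \mathrm{End}_{\mathbb C}(S_W)$ be the subring generated by all Hecke operators $T_n$, $n\ge 1$, acting diagonally. For a commutative ring $A$ the module of cusp forms with coefficients in $A$ is $S_W(A)=\mathrm{Hom}_{\mathbb Z}(\mathbb{T}_{\mathbb Z}(S_W),A)$, with the Hecke action $(Tf)(T')=f(TT')$ and the formal $q$-expansion $f(q)=\sum_{n\ge1}f(T_n)q^n$. Write $S_k(\Gamma_1(M))(A)$ for the case $W=\{k\}$ and $S^b(\Gamma_1(M))(A)$ for the case $W=\{1,\dots,b\}$; for $k\le b$, restriction of Hecke operators gives an injection $S_k(\Gamma_1(M))(A)\hookrightarrow S^b(\Gamma_1(M))(A)$. For a prime $\ell\nmid M$ the operator $[\ell]=\ell(T_\ell^2-T_{\ell^2})$ in the Hecke algebra acts in weight $k$ as $\ell^k\langle\ell\rangle$,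 where $\langle\ell\rangle$ is the diamond operator. Let $\overline{\mathbb Z}_p$ be the ring of integers of $\overline{\mathbb Q}_p$ and $v$ the valuation on it with $v(p)=1$, and put $\overline{\mathbb Z/p^m\mathbb Z}=\overline{\mathbb Z}_p/\{x: v(x)>m-1\}$; this is the direct limit of the rings $\mathcal O_K/\mathfrak p_K^{(m-1)e_K+1}$ over the finite extensions $K/\mathbb Q_p$ (with maximal ideal $\mathfrak p_K$ and ramification index $e_K$), and for $m=1$ it is $\overline{\mathbb F}_p$. Reduction mod $p^m$ means the image in $\overline{\mathbb Z/p^m\mathbb Z}$. **Proposition.** Let $\mathcal O$ be the ring of integers of a finite extension of $\mathbb Q_p$ in $\overline{\mathbb Q}_p$ and let $D\ge 1$ be an integer. Let $k_1,\dots,k_t\ge 1$ be distinct integers, let $f_i\in S_{k_i}(\Gamma_1(Np^r))(\mathcal O)$, and let $\psi_i:(\mathbb Z/N\mathbb Z)^\times\to\mathcal O^\times$ and $\eta_i:(\mathbb Z/p^r\mathbb Z)^\times\to\mathcal O^\times$ be characters such that $$[\ell]f_i=\ell^{k_i}\psi_i(\ell)\eta_i(\ell)f_i\qquad\text{for all primes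 }\ell\nmid DNp\text{ and all }i.$$ Suppose that the $q$-expansions $f_i(q)$ mod $p$, $i=1,\dots,t$, are linearly independent over $\overline{\mathbb F}_p$. Let $b\ge\max_i k_i$, let $f=\sum_{i=1}^t f_i\in S^b(\Gamma_1(Np^r))(\mathcal O)$, and suppose that $f$ is an eigenform mod $p^m$ for the operators $[\ell]$: for every prime $\ell\nmid DNp$ there is $\lambda_\ell\in\overline{\mathbb Z/p^m\mathbb Z}$ such that the reduction $\bar f$ of $f$ mod $p^m$ satisfies $[\ell]\bar f=\lambda_\ell\bar f$ in $S^b(\Gamma_1(Np^r))(\overline{\mathbb Z/p^m\mathbb Z})$. Let $h$ be the least common multiple of the orders of the characters $\eta_i$ mod $p^m$, and let $\varphi$ be Euler's function. Then $$k_1\equiv k_2\equiv\dots\equiv k_t \pmod{\varphi(p^m)/h},$$ that is, every difference $k_i-k_j$ is an integer multiple of the rational number $\varphi(p^m)/h$ (equivalently, $\varphi(p^m)$ divides $(k_i-k_j)h$). -/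

import Mathlib

section

open scoped ModularForm MatrixGroups Pointwise

/-! ### Diamond and Hecke operators on cusp forms for `Γ₁(M)` -/

/-- The group `Γ₁(M)`, as a subgroup of `GL₂(ℝ)`. -/
noncomputable abbrev levelGroup (M : ℕ) : Subgroup (GL (Fin 2) ℝ) :=
  (CongruenceSubgroup.Gamma1 M).map (Matrix.SpecialLinearGroup.mapGL ℝ)

/-- The complex vector space `S_k(Γ₁(M))` of cusp forms of weight `k`. -/
abbrev CuspSpace (M : ℕ) (k : ℕ+) : Type := CuspForm (levelGroup M) ((k : ℕ) : ℤ)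

/-- The inclusion `GL₂(ℚ) → GL₂(ℝ)`. -/
noncomputable abbrev ratToReal : GL (Fin 2) ℚ →* GL (Fin 2) ℝ :=
  Matrix.GeneralLinearGroup.map (Rat.castHom ℝ)

instance levelGroup_isFiniteRelIndex (M : ℕ) [NeZero M] (g : GL (Fin 2) ℚ) :
    (ConjAct.toConjAct (ratToReal g)⁻¹ • levelGroup M).IsFiniteRelIndex (levelGroup M) := by
  have h1 : (ConjAct.toConjAct (ratToReal g⁻¹) • levelGroup M).IsArithmetic :=
    Subgroup.IsArithmetic.conj (levelGroup M) g⁻¹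
  have h2 : (levelGroup M).IsArithmetic := inferInstance
  rw [← map_inv]
  exact ⟨(h1.is_commensurable.trans h2.is_commensurable.symm).1⟩

lemma sigma_eq_id_of_det_one {g : GL (Fin 2) ℝ} (hg : 0 < g.det.val) (c : ℂ) :
    UpperHalfPlane.σ g c = c := by
  simp only [UpperHalfPlane.σ, if_pos hg]; rfl

/-- The double coset operator `f ↦ f | [Γ g Γ]_k` on `S_k(Γ)` for `Γ = Γ₁(M)` and `det g > 0`:
it is the sum of the functions `f ∣[k] (g * γ)` over representatives `γ` of `(g⁻¹ Γ g ∩ Γ) \ Γ`,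
where `(f ∣[k] g)(z) = det(g)^(k-1) (c z + d)^(-k) f(g z)`. -/
noncomputable def doubleCosetOp (M : ℕ) [NeZero M] (k : ℕ+) (g : GL (Fin 2) ℚ)
    (hg : 0 < (ratToReal g).det.val) : Module.End ℂ (CuspSpace M k) where
  toFun f := CuspForm.trace (levelGroup M) (CuspForm.translate f (ratToReal g))
  map_add' f f' := by
    apply DFunLike.coe_injective
    simp only [FunLike.coe_add, CuspForm.coe_trace, ← Finset.sum_add_distrib]
    refine Finset.sum_congr rfl fun q _ ↦ ?_
    induction q using Quotient.inductionOn with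
    | h γ =>
      simp only [SlashInvariantForm.quotientFunc_mk]
      have e1 : (⇑(CuspForm.translate (f + f') (ratToReal g)) : UpperHalfPlane → ℂ)
          = ⇑(CuspForm.translate f (ratToReal g)) + ⇑(CuspForm.translate f' (ratToReal g)) :=
        SlashAction.add_slash ((k : ℕ) : ℤ) (ratToReal g) (⇑f) (⇑f')
      rw [e1, SlashAction.add_slash]
  map_smul' c f := by
    apply DFunLike.coe_injective
    simp only [FunLike.coe_smul, CuspForm.coe_trace, RingHom.id_apply, Finset.smul_sum]
    refine Finset.sum_congr rfl fun q _ ↦ ?_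
    induction q using Quotient.inductionOn with
    | h γ =>
      simp only [SlashInvariantForm.quotientFunc_mk]
      have hγ : (γ.val⁻¹).det = 1 :=
        Subgroup.HasDetOne.det_eq (inv_mem γ.2)
      have e1 : (⇑(CuspForm.translate (c • f) (ratToReal g)) : UpperHalfPlane → ℂ)
          = c • ⇑(CuspForm.translate f (ratToReal g)) := by
        refine (ModularForm.smul_slash _ _ _ _).trans ?_
        rw [sigma_eq_id_of_det_one hg]; rfl
      rw [e1, ModularForm.smul_slash, sigma_eq_id_of_det_one (by simp [hγ])]

/-- The matrix `diag(1, ℓ)`. -/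
noncomputable def diagOne (l : ℕ) (hl : l ≠ 0) : GL (Fin 2) ℚ :=
  Matrix.GeneralLinearGroup.mkOfDetNeZero !![1, 0; 0, (l : ℚ)] (by simpa using hl)

lemma diagOne_det_pos (l : ℕ) (hl : l ≠ 0) : 0 < (ratToReal (diagOne l hl)).det.val := by
  have : (0 : ℝ) < l := by positivity
  simpa [diagOne, Matrix.GeneralLinearGroup.mkOfDetNeZero, Matrix.det_fin_two] using this

/-- The Hecke operator `T_ℓ` on `S_k(Γ₁(M))` for a prime `ℓ`, that is the double coset operator of
`diag(1, ℓ)` (also for `ℓ ∣ M`, where it is often denoted `U_ℓ`). -/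
noncomputable def heckePrime (M : ℕ) [NeZero M] (k : ℕ+) (l : ℕ) :
    Module.End ℂ (CuspSpace M k) :=
  if hl : l ≠ 0 then doubleCosetOp M k (diagOne l hl) (diagOne_det_pos l hl) else 0

/-- For `d` prime to `M`, a matrix `σ_d ∈ SL₂(ℤ)` that is congruent to `(d⁻¹, *; 0, d)`
modulo `M`, namely `(a, -b; M, d)` with `a d + b M = 1`. -/
def diamondMatrix (M d : ℕ) (h : d.Coprime M) : SL(2, ℤ) :=
  ⟨!![Nat.gcdA d M, -Nat.gcdB d M; (M : ℤ), (d : ℤ)], by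
    have := Nat.gcd_eq_gcd_ab d M
    rw [Nat.Coprime.gcd_eq_one h] at this
    rw [Matrix.det_fin_two_of]
    push_cast at this
    linarith⟩

lemma diamondMatrix_mem (M d : ℕ) (h : d.Coprime M) :
    diamondMatrix M d h ∈ CongruenceSubgroup.Gamma0 M := by
  rw [CongruenceSubgroup.Gamma0_mem]
  change (((M : ℤ) : ℤ) : ZMod M) = 0
  simp

/-- `Γ₁(M)` is normalized by `Γ₀(M)`. -/
lemma levelGroup_conj (M : ℕ) (s : SL(2, ℤ)) (hs : s ∈ CongruenceSubgroup.Gamma0 M) :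
    levelGroup M =
      ConjAct.toConjAct (Matrix.SpecialLinearGroup.mapGL ℝ s)⁻¹ • levelGroup M := by
  have key : ∀ s ∈ CongruenceSubgroup.Gamma0 M, ∀ x ∈ CongruenceSubgroup.Gamma1 M,
      s * x * s⁻¹ ∈ CongruenceSubgroup.Gamma1 M := by
    intro s hs x hx
    rw [CongruenceSubgroup.Gamma0_mem] at hs
    rw [CongruenceSubgroup.Gamma1_mem] at hx ⊢
    obtain ⟨hx1, hx2, hx3⟩ := hx
    have hd : (s 0 0 : ZMod M) * (s 1 1 : ZMod M) = 1 := by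
      have h := s.2
      rw [Matrix.det_fin_two] at h
      have := congrArg (Int.cast : ℤ → ZMod M) h
      push_cast at this
      rw [hs] at this
      simpa using this
    simp only [Matrix.SpecialLinearGroup.coe_mul, Matrix.SpecialLinearGroup.coe_inv,
      Matrix.adjugate_fin_two, Matrix.mul_apply, Fin.sum_univ_two]
    simp [hx1, hx2, hx3, hs]
    refine ⟨?_, ?_⟩ <;> linear_combination hd
  ext y
  rw [Subgroup.mem_pointwise_smul_iff_inv_smul_mem]
  simp only [← ConjAct.toConjAct_inv, inv_inv, ConjAct.toConjAct_smul, Subgroup.mem_map]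
  constructor
  · rintro ⟨x, hx, rfl⟩
    exact ⟨s * x * s⁻¹, key s hs x hx, by simp⟩
  · rintro ⟨x, hx, e⟩
    refine ⟨s⁻¹ * x * s, ?_, ?_⟩
    · simpa using key s⁻¹ (inv_mem hs) x hx
    · rw [map_mul, map_mul, e]; simp [mul_assoc]

open Classical in
/-- The diamond operator `⟨d⟩ f = f ∣[k] σ_d` on `S_k(Γ₁(M))`, extended by `⟨d⟩ = 0` if `d` is not
prime to `M`. -/
noncomputable def diamondOp (M : ℕ) (k : ℕ+) (d : ℕ) : Module.End ℂ (CuspSpace M k) :=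
  if h : d.Coprime M then
    { toFun := fun f ↦ CuspForm.copy
        (CuspForm.translate f (Matrix.SpecialLinearGroup.mapGL ℝ (diamondMatrix M d h)))
        (⇑f ∣[((k : ℕ) : ℤ)] diamondMatrix M d h) rfl
        (levelGroup_conj M _ (diamondMatrix_mem M d h))
      map_add' := fun f f' ↦ DFunLike.coe_injective
        (SlashAction.add_slash ((k : ℕ) : ℤ) (diamondMatrix M d h) (⇑f) (⇑f'))
      map_smul' := fun c f ↦ DFunLike.coe_injective
        (ModularForm.SL_smul_slash ((k : ℕ) : ℤ) (diamondMatrix M d h) (⇑f) c) }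
  else 0

/-- The Hecke operator `T_{ℓ^s}` on `S_k(Γ₁(M))` for a prime `ℓ`, by the recursion
`T_{ℓ^(s+2)} = T_ℓ T_{ℓ^(s+1)} - ℓ^(k-1) ⟨ℓ⟩ T_{ℓ^s}`. -/
noncomputable def heckePrimePow (M : ℕ) [NeZero M] (k : ℕ+) (l : ℕ) :
    ℕ → Module.End ℂ (CuspSpace M k)
  | 0 => 1
  | 1 => heckePrime M k l
  | s + 2 => heckePrime M k l * heckePrimePow M k l (s + 1)
      - ((l : ℂ) ^ ((k : ℕ) - 1)) • (diamondOp M k l * heckePrimePow M k l s)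

/-- The Hecke operator `T_n` on `S_k(Γ₁(M))` for `n ≥ 1`: the product of the operators `T_{ℓ^s}` over
the prime powers `ℓ^s` that exactly divide `n` (these operators commute). -/
noncomputable def heckeOp (M : ℕ) [NeZero M] (k : ℕ+) (n : ℕ) : Module.End ℂ (CuspSpace M k) :=
  (n.primeFactorsList.dedup.map fun l ↦ heckePrimePow M k l (n.factorization l)).prod

lemma heckeOp_prime (M : ℕ) [NeZero M] (k : ℕ+) (l : ℕ) (hl : l.Prime) :
    heckeOp M k l = heckePrime M k l := by
  simp [heckeOp, Nat.primeFactorsList_prime hl, hl.factorization_self, heckePrimePow]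

lemma heckeOp_prime_sq (M : ℕ) [NeZero M] (k : ℕ+) (l : ℕ) (hl : l.Prime) :
    heckeOp M k (l ^ 2) = heckePrime M k l * heckePrime M k l
      - ((l : ℂ) ^ ((k : ℕ) - 1)) • diamondOp M k l := by
  have h : (l ^ 2).primeFactorsList.dedup = [l] := by
    rw [hl.primeFactorsList_pow]; simp [List.replicate]
  simp [heckeOp, h, hl.factorization_self, heckePrimePow]

/-! ### Several weights at once -/

/-- The direct sum `⨁_{k ∈ W} S_k(Γ₁(M))`, for a finite set `W` of weights. For `W = {k}` this is
`S_k(Γ₁(M))` and for `W = {1, …, b}` it is `S^b(Γ₁(M))`. -/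
abbrev CuspSum (M : ℕ) (W : Finset ℕ+) : Type := (k : W) → CuspSpace M k

/-- A family of operators acting diagonally on `⨁_{k ∈ W} S_k(Γ₁(M))`. -/
noncomputable def diagOp (M : ℕ) (W : Finset ℕ+)
    (T : (k : ℕ+) → Module.End ℂ (CuspSpace M k)) : Module.End ℂ (CuspSum M W) :=
  LinearMap.pi fun k ↦ T k ∘ₗ LinearMap.proj k

/-- The Hecke algebra `𝕋_ℤ(S)` of `S = ⨁_{k ∈ W} S_k(Γ₁(M))`: the subring of `End_ℂ(S)` generated
by the operators `T_n`, `n ≥ 1`, acting diagonally. -/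
noncomputable def heckeAlg (M : ℕ) [NeZero M] (W : Finset ℕ+) :
    Subalgebra ℤ (Module.End ℂ (CuspSum M W)) :=
  Algebra.adjoin ℤ {T | ∃ n : ℕ, 1 ≤ n ∧ T = diagOp M W fun k ↦ heckeOp M k n}

/-- `T_n` as an element of the Hecke algebra. -/
noncomputable def heckeElt (M : ℕ) [NeZero M] (W : Finset ℕ+) (n : ℕ) (hn : 1 ≤ n) :
    heckeAlg M W :=
  ⟨diagOp M W fun k ↦ heckeOp M k n, Algebra.subset_adjoin ⟨n, hn, rfl⟩⟩

/-- The stroke operator `[ℓ]`, acting as `ℓ^k ⟨ℓ⟩` in weight `k`. -/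
noncomputable def strokeOp (M : ℕ) (W : Finset ℕ+) (l : ℕ) : Module.End ℂ (CuspSum M W) :=
  diagOp M W fun k ↦ ((l : ℂ) ^ (k : ℕ)) • diamondOp M k l

/-- `[ℓ] = ℓ (T_ℓ² - T_{ℓ²})` for a prime `ℓ`. -/
lemma strokeOp_eq (M : ℕ) [NeZero M] (W : Finset ℕ+) (l : ℕ) (hl : l.Prime) :
    strokeOp M W l = (l : ℤ) • ((diagOp M W fun k ↦ heckeOp M k l) ^ 2
      - diagOp M W fun k ↦ heckeOp M k (l ^ 2)) := by
  refine LinearMap.ext fun f ↦ funext fun k ↦ ?_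
  have hk : (l : ℂ) ^ ((k : ℕ+) : ℕ) = (l : ℂ) * (l : ℂ) ^ (((k : ℕ+) : ℕ) - 1) := by
    rw [← pow_succ', Nat.sub_add_cancel (k : ℕ+).pos]
  have h : diagOp M W (fun k ↦ heckeOp M k (l ^ 2)) f k =
      heckePrime M k l (heckePrime M k l (f k))
        - ((l : ℂ) ^ (((k : ℕ+) : ℕ) - 1)) • diamondOp M k l (f k) := by
    change heckeOp M k (l ^ 2) (f k) = _
    rw [heckeOp_prime_sq M k l hl]; rfl
  have h' : ((diagOp M W fun k ↦ heckeOp M k l) ^ 2) f k =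
      heckePrime M k l (heckePrime M k l (f k)) := by
    rw [pow_two]
    change heckeOp M k l (heckeOp M k l (f k)) = _
    rw [heckeOp_prime M k l hl]
  change ((l : ℂ) ^ ((k : ℕ+) : ℕ)) • diamondOp M k l (f k) = (l : ℤ) •
    (((diagOp M W fun k ↦ heckeOp M k l) ^ 2) f k - diagOp M W (fun k ↦ heckeOp M k (l ^ 2)) f k)
  rw [h, h', sub_sub_cancel, hk, mul_smul, natCast_zsmul, Nat.cast_smul_eq_nsmul]

/-- The stroke operator `[ℓ]`, for a prime `ℓ`, as an element of the Hecke algebra. -/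
noncomputable def strokeElt (M : ℕ) [NeZero M] (W : Finset ℕ+) (l : ℕ) (hl : l.Prime) :
    heckeAlg M W :=
  ⟨strokeOp M W l, by
    rw [strokeOp_eq M W l hl]
    refine Subalgebra.smul_mem _ (sub_mem (pow_mem ?_ 2) ?_) _
    · exact Algebra.subset_adjoin ⟨l, hl.one_le, rfl⟩
    · exact Algebra.subset_adjoin ⟨l ^ 2, Nat.one_le_pow _ _ hl.pos, rfl⟩⟩

/-- The inclusion `⨁_{k ∈ V} S_k → ⨁_{k ∈ W} S_k` for `V ⊆ W`. -/
noncomputable def cuspIncl (M : ℕ) (V W : Finset ℕ+) : CuspSum M V →ₗ[ℂ] CuspSum M W :=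
  LinearMap.pi fun k ↦ if h : (k : ℕ+) ∈ V then LinearMap.proj (⟨k, h⟩ : V) else 0

/-- The projection `⨁_{k ∈ W} S_k → ⨁_{k ∈ V} S_k` for `V ⊆ W`. -/
noncomputable def cuspProj (M : ℕ) {V W : Finset ℕ+} (h : V ⊆ W) :
    CuspSum M W →ₗ[ℂ] CuspSum M V :=
  LinearMap.pi fun k ↦ LinearMap.proj (⟨k, h k.2⟩ : W)

lemma cuspProj_cuspIncl (M : ℕ) {V W : Finset ℕ+} (h : V ⊆ W) :
    cuspProj M h ∘ₗ cuspIncl M V W = LinearMap.id := by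
  ext f k
  simp [cuspProj, cuspIncl]

lemma cuspProj_diagOp (M : ℕ) {V W : Finset ℕ+} (h : V ⊆ W)
    (T : (k : ℕ+) → Module.End ℂ (CuspSpace M k)) :
    cuspProj M h ∘ₗ diagOp M W T = diagOp M V T ∘ₗ cuspProj M h := rfl

lemma exists_heckeAlg_restrict (M : ℕ) [NeZero M] {V W : Finset ℕ+} (h : V ⊆ W)
    (T : Module.End ℂ (CuspSum M W)) (hT : T ∈ heckeAlg M W) :
    ∃ T' ∈ heckeAlg M V, cuspProj M h ∘ₗ T = T' ∘ₗ cuspProj M h := by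
  induction hT using Algebra.adjoin_induction with
  | mem x hx =>
    obtain ⟨n, hn, rfl⟩ := hx
    exact ⟨_, (heckeElt M V n hn).2, cuspProj_diagOp M h _⟩
  | algebraMap z =>
    refine ⟨algebraMap ℤ _ z, Subalgebra.algebraMap_mem _ z, ?_⟩
    refine LinearMap.ext fun f ↦ ?_
    simp
  | add x y _ _ hx hy =>
    obtain ⟨x', hx', ex⟩ := hx
    obtain ⟨y', hy', ey⟩ := hy
    exact ⟨x' + y', add_mem hx' hy', by rw [LinearMap.comp_add, ex, ey, LinearMap.add_comp]⟩
  | mul x y _ _ hx hy =>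
    obtain ⟨x', hx', ex⟩ := hx
    obtain ⟨y', hy', ey⟩ := hy
    refine ⟨x' * y', mul_mem hx' hy', ?_⟩
    rw [Module.End.mul_eq_comp, Module.End.mul_eq_comp, ← LinearMap.comp_assoc, ex,
      LinearMap.comp_assoc, ey, LinearMap.comp_assoc]

lemma heckeAlg_restrict (M : ℕ) [NeZero M] {V W : Finset ℕ+} (h : V ⊆ W)
    (T : Module.End ℂ (CuspSum M W)) (hT : T ∈ heckeAlg M W) :
    cuspProj M h ∘ₗ T ∘ₗ cuspIncl M V W ∈ heckeAlg M V ∧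
      cuspProj M h ∘ₗ T = (cuspProj M h ∘ₗ T ∘ₗ cuspIncl M V W) ∘ₗ cuspProj M h := by
  obtain ⟨T', hT', e⟩ := exists_heckeAlg_restrict M h T hT
  have : cuspProj M h ∘ₗ T ∘ₗ cuspIncl M V W = T' := by
    rw [← LinearMap.comp_assoc, e, LinearMap.comp_assoc, cuspProj_cuspIncl, LinearMap.comp_id]
  rw [this]
  exact ⟨hT', e⟩

/-- The ring homomorphism `π : 𝕋_ℤ(⨁_{k ∈ W} S_k) → 𝕋_ℤ(⨁_{k ∈ V} S_k)` for `V ⊆ W`, restriction of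
Hecke operators. -/
noncomputable def heckeRestrict (M : ℕ) [NeZero M] {V W : Finset ℕ+} (h : V ⊆ W) :
    heckeAlg M W →ₐ[ℤ] heckeAlg M V where
  toFun T := ⟨cuspProj M h ∘ₗ T.1 ∘ₗ cuspIncl M V W, (heckeAlg_restrict M h T.1 T.2).1⟩
  map_one' := Subtype.ext (cuspProj_cuspIncl M h)
  map_mul' x y := by
    refine Subtype.ext ?_
    have := (heckeAlg_restrict M h x.1 x.2).2
    simp only [MulMemClass.coe_mul, Module.End.mul_eq_comp, LinearMap.comp_assoc] at this ⊢
    rw [← LinearMap.comp_assoc, this]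
    simp only [LinearMap.comp_assoc]
  map_zero' := Subtype.ext (by simp)
  map_add' x y := Subtype.ext (by simp [LinearMap.comp_add, LinearMap.add_comp])
  commutes' z := Subtype.ext (by
    refine LinearMap.ext fun f ↦ ?_
    have := LinearMap.congr_fun (cuspProj_cuspIncl M h) f
    simp only [LinearMap.comp_apply, LinearMap.id_apply] at this
    simp [this])

/-! ### Cusp forms with coefficients in a ring -/

/-- The module `S(A) = Hom_ℤ(𝕋_ℤ(S), A)` of cusp forms in `S = ⨁_{k ∈ W} S_k(Γ₁(M))` with
coefficients in a commutative ring `A`. -/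
abbrev CuspCoeff (M : ℕ) [NeZero M] (W : Finset ℕ+) (A : Type*) [CommRing A] : Type _ :=
  heckeAlg M W →ₗ[ℤ] A

namespace CuspCoeff

variable {M : ℕ} [NeZero M] {V W : Finset ℕ+} {A B : Type*} [CommRing A] [CommRing B]

/-- The action of the Hecke algebra on `S(A)`: `(T f)(T') = f(T T')`. -/
noncomputable def act (T : heckeAlg M W) (f : CuspCoeff M W A) : CuspCoeff M W A :=
  f ∘ₗ LinearMap.mulLeft ℤ T

/-- `T f = c f` in `S(A)`. -/
def IsEigen (T : heckeAlg M W) (f : CuspCoeff M W A) (c : A) : Prop :=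
  act T f = c • f

/-- The base change map `S(A) → S(B)` along a ring homomorphism `A → B`. -/
noncomputable def baseChange (φ : A →+* B) (f : CuspCoeff M W A) : CuspCoeff M W B :=
  φ.toAddMonoidHom.toIntLinearMap ∘ₗ f

/-- For `V ⊆ W`, the injection of the cusp forms in `⨁_{k ∈ V} S_k` with coefficients in `A` into
those in `⨁_{k ∈ W} S_k`. -/
noncomputable def extend (h : V ⊆ W) (f : CuspCoeff M V A) : CuspCoeff M W A :=
  f ∘ₗ (heckeRestrict M h).toLinearMap

open Classical in
/-- The formal `q`-expansion `∑_{n ≥ 1} f(T_n) q^n`. -/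
noncomputable def qExp (f : CuspCoeff M W A) : PowerSeries A :=
  PowerSeries.mk fun n ↦ if hn : 1 ≤ n then f (heckeElt M W n hn) else 0

end CuspCoeff

/-! ### Congruences modulo `p^m` of `p`-adic integers -/

/-- The ring `𝒪` of integers of an algebraic extension `K ⊆ ℚ̄_p` of `ℚ_p`. -/
abbrev padicIntegers (p : ℕ) [Fact p.Prime] (K : IntermediateField ℚ_[p] (PadicAlgCl p)) :
    Type := integralClosure ℤ_[p] K

/-- The ring `ℤ̄_p` of integers of `ℚ̄_p`. -/
abbrev padicIntBar (p : ℕ) [Fact p.Prime] : Type := integralClosure ℤ_[p] (PadicAlgCl p)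

lemma padicIntBar_norm_le_one (p : ℕ) [Fact p.Prime] (x : padicIntBar p) :
    ‖(x : PadicAlgCl p)‖ ≤ 1 := by
  let v : Valuation (PadicAlgCl p) NNReal := Valued.v
  let ι : ℤ_[p] →+* v.integer :=
    ((algebraMap ℚ_[p] (PadicAlgCl p)).comp (PadicInt.Coe.ringHom (p := p))).codRestrict
      v.integer fun y ↦ by
        change ‖algebraMap ℚ_[p] (PadicAlgCl p) (y : ℚ_[p])‖₊ ≤ 1
        rw [← NNReal.coe_le_coe, coe_nnnorm, PadicAlgCl.norm_extends]
        exact y.2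
  have h : IsIntegral v.integer (x : PadicAlgCl p) :=
    IsIntegral.map_of_comp_eq (R := ℤ_[p]) ι (RingHom.id _) (by ext; rfl) x.2
  exact (Valuation.integer.integers v).mem_of_integral h

/-- The ideal of all `x ∈ ℤ̄_p` with `v(x) > m - 1`, where `v` is the valuation with `v(p) = 1`;
that is `|x| |p| < |p|^m`. If `K / ℚ_p` is finite with ramification index `e` and `𝔭` is the maximal
ideal of its ring of integers `𝒪`, then `v` takes its values on `𝒪` in `(1/e) ℤ`, so that this ideal
meets `𝒪` in `𝔭^((m-1)e+1)` for `m ≥ 1`. -/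
noncomputable def modPowIdeal (p : ℕ) [Fact p.Prime] (m : ℕ) : Ideal (padicIntBar p) where
  carrier := {x | ‖(x : PadicAlgCl p)‖ * ‖(p : PadicAlgCl p)‖ < ‖(p : PadicAlgCl p)‖ ^ m}
  zero_mem' := by
    have : (p : PadicAlgCl p) ≠ 0 := Nat.cast_ne_zero.2 (Fact.out : p.Prime).ne_zero
    simp only [Set.mem_ofPred_eq, ZeroMemClass.coe_zero, norm_zero, zero_mul]
    positivity
  add_mem' {x y} hx hy := by
    simp only [Set.mem_ofPred_eq] at hx hy ⊢
    have := IsUltrametricDist.norm_add_le_max (x : PadicAlgCl p) (y : PadicAlgCl p)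
    refine lt_of_le_of_lt (mul_le_mul_of_nonneg_right this (norm_nonneg _)) ?_
    rcases max_choice ‖(x : PadicAlgCl p)‖ ‖(y : PadicAlgCl p)‖ with h | h <;> rw [h] <;> assumption
  smul_mem' c {x} hx := by
    simp only [Set.mem_ofPred_eq, smul_eq_mul, MulMemClass.coe_mul, norm_mul] at hx ⊢
    refine lt_of_le_of_lt (mul_le_mul_of_nonneg_right ?_ (norm_nonneg _)) hx
    exact mul_le_of_le_one_left (norm_nonneg _) (padicIntBar_norm_le_one p c)

/-- The ring of residues modulo `p^m`, the direct limit over the finite extensions `K / ℚ_p` of the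
rings `𝒪_K / 𝔭_K^((m-1)e_K+1)`. For `m = 1` it is the residue field `𝔽̄_p` of `ℤ̄_p`. -/
abbrev ZModBar (p : ℕ) [Fact p.Prime] (m : ℕ) : Type := padicIntBar p ⧸ modPowIdeal p m

/-- Reduction modulo `p^m` on the ring of integers of `K`. -/
noncomputable def redModPow (p : ℕ) [Fact p.Prime] (m : ℕ)
    (K : IntermediateField ℚ_[p] (PadicAlgCl p)) : padicIntegers p K →+* ZModBar p m :=
  (Ideal.Quotient.mk (modPowIdeal p m)).comp
    (AlgHom.mapIntegralClosure (K.val.restrictScalars ℤ_[p])).toRingHom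

end

/-! ### Norms and linear relations modulo `p^m` in `ℤ̄_p` -/

lemma mem_modPowIdeal {p : ℕ} [Fact p.Prime] {m : ℕ} {x : padicIntBar p} :
    x ∈ modPowIdeal p m ↔
      ‖(x : PadicAlgCl p)‖ * ‖(p : PadicAlgCl p)‖ < ‖(p : PadicAlgCl p)‖ ^ m :=
  Iff.rfl

lemma PadicAlgCl.norm_natCast_self (p : ℕ) [Fact p.Prime] :
    ‖(p : PadicAlgCl p)‖ = (p : ℝ)⁻¹ := by
  rw [← map_natCast (algebraMap ℚ_[p] (PadicAlgCl p)), PadicAlgCl.norm_extends, Padic.norm_p]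

lemma PadicAlgCl.norm_natCast_self_pos (p : ℕ) [Fact p.Prime] : 0 < ‖(p : PadicAlgCl p)‖ :=
  norm_pos_iff.2 (Nat.cast_ne_zero.2 (Fact.out : p.Prime).ne_zero)

lemma mem_modPowIdeal_one {p : ℕ} [Fact p.Prime] {x : padicIntBar p} :
    x ∈ modPowIdeal p 1 ↔ ‖(x : PadicAlgCl p)‖ < 1 := by
  rw [mem_modPowIdeal, pow_one]
  exact mul_lt_iff_lt_one_left (PadicAlgCl.norm_natCast_self_pos p)

/-- An element of `ℚ̄_p` of norm at most `1` is integral over `ℤ_p`. -/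
lemma PadicAlgCl.isIntegral_of_norm_le_one {p : ℕ} [Fact p.Prime] {x : PadicAlgCl p}
    (hx : ‖x‖ ≤ 1) : IsIntegral ℤ_[p] x := by
  have hint : IsIntegral ℚ_[p] x := Algebra.IsIntegral.isIntegral x
  -- The norm on `ℚ̄_p` is the spectral norm, so it is at most `1` exactly when the minimal
  -- polynomial has coefficients in `ℤ_p`.
  have hcoeff : ∀ n, ‖(minpoly ℚ_[p] x).coeff n‖ ≤ 1 :=
    (spectralValue_le_one_iff (minpoly.monic hint)).1 hx
  have hlift : minpoly ℚ_[p] x ∈ Polynomial.lifts (algebraMap ℤ_[p] ℚ_[p]) := by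
    rw [Polynomial.lifts_iff_coeff_lifts]
    exact fun n ↦ ⟨⟨_, hcoeff n⟩, rfl⟩
  obtain ⟨q, hq, -, hmonic⟩ := Polynomial.lifts_and_degree_eq_and_monic hlift (minpoly.monic hint)
  refine ⟨q, hmonic, ?_⟩
  rw [IsScalarTower.algebraMap_eq ℤ_[p] ℚ_[p] (PadicAlgCl p), ← Polynomial.eval₂_map, hq]
  exact minpoly.aeval ℚ_[p] x

/-- If `p^m` divides an integer in the sense of `modPowIdeal`, it does so in `ℤ`. -/
lemma dvd_of_intCast_mem_modPowIdeal {p : ℕ} [Fact p.Prime] {m : ℕ} {z : ℤ}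
    (hz : (z : padicIntBar p) ∈ modPowIdeal p m) : ((p ^ m : ℕ) : ℤ) ∣ z := by
  have hp : (0 : ℝ) < p := Nat.cast_pos.2 (Fact.out : p.Prime).pos
  have h : ‖(z : ℚ_[p])‖ * (p : ℝ)⁻¹ < (p : ℝ)⁻¹ ^ m := by
    rw [mem_modPowIdeal, PadicAlgCl.norm_natCast_self] at hz
    rwa [← PadicAlgCl.norm_extends, map_intCast]
  -- The ideal only requires `v(z) > m - 1`; for an integer `z` the valuation is integral or
  -- infinite, so this means `v(z) ≥ m`.
  have h' : ‖(z : ℚ_[p])‖ < (p : ℝ) ^ (-(m : ℤ) + 1) := by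
    rw [zpow_add_one₀ hp.ne', zpow_neg, zpow_natCast, ← inv_pow]
    rwa [← lt_div_iff₀ (inv_pos.2 hp), div_inv_eq_mul] at h
  rwa [Nat.cast_pow, ← Padic.norm_int_le_pow_iff_dvd, Padic.norm_le_pow_iff_norm_lt_pow_add_one]

/-- Power series over `ℤ̄_p` that are linearly independent modulo `p` have no nontrivial linear
relations modulo `p^m`. -/
lemma mem_modPowIdeal_of_sum_mul_coeff_mem {p : ℕ} [Fact p.Prime] {m : ℕ} {ι : Type*} [Fintype ι]
    {v : ι → PowerSeries (padicIntBar p)}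
    (hv : LinearIndependent (ZModBar p 1)
      fun i ↦ PowerSeries.map (Ideal.Quotient.mk (modPowIdeal p 1)) (v i))
    {x : ι → padicIntBar p}
    (hx : ∀ n, ∑ i, x i * PowerSeries.coeff n (v i) ∈ modPowIdeal p m) (i : ι) :
    x i ∈ modPowIdeal p m := by
  -- Membership in the ideal is a bound on the norm, so it is enough to treat a coefficient of
  -- largest norm.
  obtain ⟨j, -, hj⟩ := Finset.exists_max_image Finset.univ
    (fun i ↦ ‖(x i : PadicAlgCl p)‖) ⟨i, Finset.mem_univ i⟩
  suffices hxj : x j ∈ modPowIdeal p m from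
    lt_of_le_of_lt (mul_le_mul_of_nonneg_right (hj i (Finset.mem_univ i)) (norm_nonneg _)) hxj
  by_contra hxj
  have hj0 : (x j : PadicAlgCl p) ≠ 0 := fun h ↦ hxj <| by
    rw [(Subtype.ext h : x j = 0)]
    exact zero_mem _
  have hjpos : 0 < ‖(x j : PadicAlgCl p)‖ := norm_pos_iff.2 hj0
  have hy : ∀ i, IsIntegral ℤ_[p] ((x i : PadicAlgCl p) / x j) := fun i ↦
    PadicAlgCl.isIntegral_of_norm_le_one <| by
      rw [norm_div]
      exact div_le_one_of_le₀ (hj i (Finset.mem_univ i)) hjpos.le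
  let y : ι → padicIntBar p := fun i ↦ ⟨_, hy i⟩
  have hxy : ∀ i, x i = x j * y i := fun i ↦ Subtype.ext (mul_div_cancel₀ _ hj0).symm
  have hsum : ∀ n, ∑ i, y i * PowerSeries.coeff n (v i) ∈ modPowIdeal p 1 := fun n ↦ by
    have h := hx n
    rw [Finset.sum_congr rfl fun i _ ↦ by rw [hxy i, mul_assoc], ← Finset.mul_sum] at h
    -- With `s` the sum for `y`, the relation and `x j ∉ modPowIdeal p m` give `|x_j| |s| |p| <
    -- |p|^m ≤ |x_j| |p|`, whence `|s| < 1`.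
    rw [mem_modPowIdeal, MulMemClass.coe_mul, norm_mul] at h
    rw [mem_modPowIdeal, not_lt] at hxj
    rw [mem_modPowIdeal_one]
    have h' := h.trans_le hxj
    rw [mul_right_comm] at h'
    exact (mul_lt_iff_lt_one_right
      (mul_pos hjpos (PadicAlgCl.norm_natCast_self_pos p))).1 h'
  have hzero := Fintype.linearIndependent_iff.1 hv
    (fun i ↦ Ideal.Quotient.mk (modPowIdeal p 1) (y i)) (by
      ext n
      have := Ideal.Quotient.eq_zero_iff_mem.2 (hsum n)
      simpa only [map_sum, map_mul, PowerSeries.coeff_smul, PowerSeries.coeff_map, smul_eq_mul,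
        map_zero] using this) j
  have h1 := mem_modPowIdeal_one.1 (Ideal.Quotient.eq_zero_iff_mem.1 hzero)
  have : (y j : PadicAlgCl p) = 1 := div_self hj0
  rw [this, norm_one] at h1
  exact lt_irrefl _ h1

/-! ### Hecke eigenvalues across several weights -/

section HeckeRestrict

variable (M : ℕ) {V W : Finset ℕ+} (h : V ⊆ W)

lemma cuspProj_diagOp_cuspIncl (T : (k : ℕ+) → Module.End ℂ (CuspSpace M k)) :
    cuspProj M h ∘ₗ diagOp M W T ∘ₗ cuspIncl M V W = diagOp M V T := by
  rw [← LinearMap.comp_assoc, cuspProj_diagOp, LinearMap.comp_assoc, cuspProj_cuspIncl,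
    LinearMap.comp_id]

variable [NeZero M]

lemma heckeRestrict_heckeElt (n : ℕ) (hn : 1 ≤ n) :
    heckeRestrict M h (heckeElt M W n hn) = heckeElt M V n hn :=
  Subtype.ext (cuspProj_diagOp_cuspIncl M h _)

lemma heckeRestrict_strokeElt (l : ℕ) (hl : l.Prime) :
    heckeRestrict M h (strokeElt M W l hl) = strokeElt M V l hl :=
  Subtype.ext (cuspProj_diagOp_cuspIncl M h _)

end HeckeRestrict

namespace CuspCoeff

variable {M : ℕ} [NeZero M] {V W : Finset ℕ+} {A : Type*} [CommRing A]

lemma extend_heckeElt (h : V ⊆ W) (f : CuspCoeff M V A) (n : ℕ) (hn : 1 ≤ n) :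
    extend h f (heckeElt M W n hn) = PowerSeries.coeff n (qExp f) := by
  rw [qExp, PowerSeries.coeff_mk, dif_pos hn]
  exact congrArg f (heckeRestrict_heckeElt M h n hn)

/-- Restriction of Hecke operators is a ring homomorphism matching `[ℓ]` and `T_n` in the two
algebras, so the eigenvalue equation in weights `V` can be read off, coefficient by coefficient, in
weights `W`. -/
lemma extend_strokeElt_mul_heckeElt (h : V ⊆ W) {f : CuspCoeff M V A} {l : ℕ} {hl : l.Prime} {c : A}
    (hf : IsEigen (strokeElt M V l hl) f c) (n : ℕ) (hn : 1 ≤ n) :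
    extend h f (strokeElt M W l hl * heckeElt M W n hn) = c * PowerSeries.coeff n (qExp f) := by
  have h1 := LinearMap.congr_fun hf (heckeElt M V n hn)
  rw [qExp, PowerSeries.coeff_mk, dif_pos hn]
  refine Eq.trans (congrArg f ?_) h1
  change heckeRestrict M h _ = _
  rw [map_mul, heckeRestrict_heckeElt, heckeRestrict_strokeElt]
  rfl

/-- If the cusp forms `f i` are linearly independent modulo `p` and their sum is an eigenform of
`[ℓ]` modulo `p^m`, then the `[ℓ]`-eigenvalues of the `f i` agree modulo `p^m`. -/
lemma redModPow_eigenvalue_eq {p : ℕ} [Fact p.Prime] {m : ℕ}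
    {K : IntermediateField ℚ_[p] (PadicAlgCl p)} {ι : Type*} [Fintype ι] {V : ι → Finset ℕ+}
    (hV : ∀ i, V i ⊆ W) {f : (i : ι) → CuspCoeff M (V i) (padicIntegers p K)}
    (hlin : LinearIndependent (ZModBar p 1)
      fun i ↦ PowerSeries.map (redModPow p 1 K) (qExp (f i)))
    {l : ℕ} {hl : l.Prime} {μ : ι → padicIntegers p K}
    (hμ : ∀ i, IsEigen (strokeElt M (V i) l hl) (f i) (μ i)) {c : ZModBar p m}
    (hc : IsEigen (strokeElt M W l hl)
      (baseChange (redModPow p m K) (∑ i, extend (hV i) (f i))) c) (i : ι) :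
    redModPow p m K (μ i) = c := by
  obtain ⟨c, rfl⟩ := Ideal.Quotient.mk_surjective c
  let φ : padicIntegers p K →+* padicIntBar p :=
    (AlgHom.mapIntegralClosure (K.val.restrictScalars ℤ_[p])).toRingHom
  refine Ideal.Quotient.eq.2 (mem_modPowIdeal_of_sum_mul_coeff_mem
    (v := fun i ↦ PowerSeries.map φ (qExp (f i))) (x := fun i ↦ φ (μ i) - c) hlin (fun n ↦ ?_) i)
  rcases Nat.eq_zero_or_pos n with rfl | hn
  -- There is no `T_0`: the constant term of `qExp` is `0` by definition.
  · simp [qExp]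
  have h := LinearMap.congr_fun hc (heckeElt M W n hn)
  replace h : redModPow p m K
      ((∑ i, extend (hV i) (f i)) (strokeElt M W l hl * heckeElt M W n hn)) =
      Ideal.Quotient.mk _ c * redModPow p m K
        ((∑ i, extend (hV i) (f i)) (heckeElt M W n hn)) := h
  simp only [LinearMap.sum_apply, extend_heckeElt,
    extend_strokeElt_mul_heckeElt (hV _) (hμ _)] at h
  have hred : ∀ a, redModPow p m K a = Ideal.Quotient.mk (modPowIdeal p m) (φ a) := fun _ ↦ rfl
  rw [hred, hred, ← map_mul, Ideal.Quotient.eq] at h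
  simpa only [map_sum, map_mul, Finset.mul_sum, ← Finset.sum_sub_distrib, ← sub_mul,
    PowerSeries.coeff_map] using h

end CuspCoeff

/-! ### The choice of `ℓ` and the congruence of weights -/

/-- There are arbitrarily large primes that are `1` modulo `N` and a primitive root modulo a power
of an odd prime `p ∤ N`. -/
lemma exists_prime_gt_primitive_root {p : ℕ} [Fact p.Prime] (hp : p ≠ 2) {N : ℕ} [NeZero N]
    (hN : ¬ p ∣ N) (m B : ℕ) :
    ∃ l > B, l.Prime ∧ (l : ZMod N) = 1 ∧ orderOf (l : ZMod (p ^ m)) = Nat.totient (p ^ m) := by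
  have hpp : p.Prime := Fact.out
  have hcop : (p ^ m).Coprime N := Nat.Coprime.pow_left _ (hpp.coprime_iff_not_dvd.2 hN)
  have : NeZero (p ^ m) := ⟨pow_ne_zero _ hpp.ne_zero⟩
  have := ZMod.isCyclic_units_of_prime_pow p hpp hp m
  obtain ⟨g, hg⟩ := IsCyclic.exists_generator (α := (ZMod (p ^ m))ˣ)
  let e := ZMod.chineseRemainder hcop
  have hu : IsUnit (e.symm ((g : ZMod (p ^ m)), 1)) :=
    (Prod.isUnit_iff.2 ⟨g.isUnit, isUnit_one⟩).map e.symm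
  obtain ⟨l, hlB, hl, hle⟩ := Nat.forall_exists_prime_gt_and_eq_mod hu B
  have hle' := congrArg e hle
  rw [map_natCast, RingEquiv.apply_symm_apply] at hle'
  refine ⟨l, hlB, hl, by simpa using congrArg Prod.snd hle', ?_⟩
  have h1 : (l : ZMod (p ^ m)) = g := by simpa using congrArg Prod.fst hle'
  rw [h1, orderOf_units, orderOf_eq_card_of_forall_mem_zpowers hg, Nat.card_eq_fintype_card,
    ZMod.card_units_eq_totient]

theorem proposition4p2 (p : ℕ) [Fact p.Prime] (hp : p ≠ 2)
    (N r D m : ℕ) [NeZero N] (hN : ¬ p ∣ N) (hD : 0 < D) (hm : 0 < m)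
    (K : IntermediateField ℚ_[p] (PadicAlgCl p)) [FiniteDimensional ℚ_[p] K]
    (t : ℕ) (k : Fin t → ℕ+) (hk : Function.Injective k) (b : ℕ+) (hb : ∀ i, k i ≤ b)
    (f : (i : Fin t) → CuspCoeff (N * p ^ r) {k i} (padicIntegers p K))
    (ψ : Fin t → DirichletCharacter (padicIntegers p K) N)
    (η : Fin t → DirichletCharacter (padicIntegers p K) (p ^ r))
    (hf : ∀ (i : Fin t) (l : ℕ) (hl : l.Prime), ¬ l ∣ D * N * p →
      CuspCoeff.IsEigen (strokeElt (N * p ^ r) {k i} l hl) (f i)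
        ((l : padicIntegers p K) ^ (k i : ℕ) * ψ i (l : ZMod N) * η i (l : ZMod (p ^ r))))
    (hlin : LinearIndependent (ZModBar p 1)
      fun i ↦ PowerSeries.map (redModPow p 1 K) (CuspCoeff.qExp (f i)))
    (F : CuspCoeff (N * p ^ r) (Finset.Icc 1 b) (padicIntegers p K))
    (hF : F = ∑ i, CuspCoeff.extend
      (Finset.singleton_subset_iff.2 (Finset.mem_Icc.2 ⟨one_le, hb i⟩)) (f i))
    (heig : ∀ (l : ℕ) (hl : l.Prime), ¬ l ∣ D * N * p → ∃ c : ZModBar p m,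
      CuspCoeff.IsEigen (strokeElt (N * p ^ r) (Finset.Icc 1 b) l hl)
        (CuspCoeff.baseChange (redModPow p m K) F) c) :
    ∀ i j : Fin t, ((k i : ℕ) : ℚ) ≡ ((k j : ℕ) : ℚ)
      [PMOD (Nat.totient (p ^ m) : ℚ) /
        (Finset.univ.lcm fun i ↦ orderOf ((η i).ringHomComp (redModPow p m K)) : ℕ)] := by
  have hpp : p.Prime := Fact.out
  intro i j
  set h : ℕ := Finset.univ.lcm fun i ↦ orderOf ((η i).ringHomComp (redModPow p m K)) with hh
  have hh0 : h ≠ 0 := by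
    rw [hh, Ne, Finset.lcm_eq_zero_iff]
    rintro ⟨a, -, ha⟩
    exact (MulChar.orderOf_pos _).ne' ha
  obtain ⟨l, hlB, hl, hlN, hord⟩ := exists_prime_gt_primitive_root hp hN m (D * N * p)
  have hl' : ¬ l ∣ D * N * p := Nat.not_dvd_of_pos_of_lt
    (mul_pos (mul_pos hD (NeZero.pos N)) hpp.pos) hlB
  have hlp : IsUnit (l : ZMod (p ^ r)) :=
    (ZMod.isUnit_iff_coprime _ _).2 <| Nat.Coprime.pow_right _ <|
      hl.coprime_iff_not_dvd.2 fun hd ↦ hl' (hd.mul_left _)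
  obtain ⟨c, hc⟩ := heig l hl hl'
  rw [hF] at hc
  -- Here `ψ_a(ℓ) = 1` because `ℓ ≡ 1` mod `N`, and `η_a(ℓ)^h = 1` mod `p^m` because the order of
  -- the reduced character divides `h` and `ℓ` is a unit mod `p^r`.
  have hpow : ∀ a, (l : ZModBar p m) ^ ((k a : ℕ) * h) = c ^ h := fun a ↦ by
    rw [← CuspCoeff.redModPow_eigenvalue_eq _ hlin (fun a ↦ hf a l hl hl') hc a, hlN, map_one,
      mul_one, map_mul, map_pow, map_natCast, mul_pow, ← pow_mul]
    have hχ : ((η a).ringHomComp (redModPow p m K)) ^ h = 1 :=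
      orderOf_dvd_iff_pow_eq_one.1 (Finset.dvd_lcm (Finset.mem_univ a))
    have h2 := MulChar.pow_apply' ((η a).ringHomComp (redModPow p m K)) hh0 (l : ZMod (p ^ r))
    rw [hχ, MulChar.one_apply hlp, MulChar.ringHomComp_apply] at h2
    rw [← h2, mul_one]
  have hdvd : ((p ^ m : ℕ) : ℤ) ∣ (l : ℤ) ^ ((k i : ℕ) * h) - (l : ℤ) ^ ((k j : ℕ) * h) := by
    refine dvd_of_intCast_mem_modPowIdeal (Ideal.Quotient.eq_zero_iff_mem.1 ?_)
    rw [map_intCast]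
    push_cast
    rw [hpow i, hpow j, sub_self]
  -- Equal powers of `ℓ` force congruent exponents modulo its order `φ(p^m)`, which is positive, so
  -- that `ℓ` has finite order.
  have hmod : (k i : ℕ) * h ≡ (k j : ℕ) * h [MOD Nat.totient (p ^ m)] := by
    rw [← hord, ← (orderOf_pos_iff.1 (hord ▸ Nat.totient_pos.2 (pow_pos hpp.pos m)) :
      IsOfFinOrder (l : ZMod (p ^ m))).pow_eq_pow_iff_modEq]
    rw [← ZMod.intCast_zmod_eq_zero_iff_dvd] at hdvd
    push_cast at hdvd
    exact sub_eq_zero.1 hdvd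
  obtain ⟨z, hz⟩ := Nat.modEq_iff_dvd.1 hmod
  refine AddCommGroup.modEq_iff_zsmul.2 ⟨z, ?_⟩
  have hz' := congrArg (Int.cast : ℤ → ℚ) hz
  push_cast at hz'
  have hq : (h : ℚ) ≠ 0 := Nat.cast_ne_zero.2 hh0
  rw [zsmul_eq_mul, mul_div_assoc', div_eq_iff hq, sub_mul, hz', mul_comm]
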